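/- Let $K$ be a field, $L/K$ a cyclic Galois extension of degree $n$, $\sigma$ a generator of $\mathrm{Gal}(L/K)$, $N$ the norm map from $L$ to $K$, and let $R=L[x;\sigma]$ be the skew polynomial ring, whose elements are the polynomials $\sum_i a_i x^i$ with $a_i\in L$ and whose multiplication is determined by $xa=\sigma(a)x$ for $a\in L$. Let $F\in K[y]$ be a monic irreducible polynomial of degree $s$ with constant coefficient $F_0$, put $E=K[y]/(F)$ and $R_F=R/RF(x^n)$ (the element $F(x^n)$ is central in $R$), and regard $R_F$ as an $E$-algebra, the class of $g(y)$ acting as that of $g(x^n)$. (0) If $K$ is finite and $F\neq y$, then $R_F$ is isomorphic to $M_n(E)$ as an $E$-algebra. Now let $K$ be arbitrary again, suppose that $R_F\cong M_n(E)$ as $E$-algebras, and let $\varphi:R_F\to M_n(E)$ be any $E$-algebra isomorphism. For $a\in R$ let $\mathrm{rank}(a)$ be the rank of the matrix $\varphi(a+RF(x^n))$. Let $k\ge 0$ be an integer and let $a=\sum_i a_ix^i\in R$ be nonzero of degree at most $sk$. Then: (1) $\mathrm{rank}(a)\ge n-k$; (2) if $\mathrm{rank}(a)=n-k$, then $a_{sk}\neq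 0$ and $$\frac{N(a_0)}{N(a_{sk})}=(-1)^{sk(n-1)}F_0^{\,k}.$$ -/

import Mathlib

/-! Skew polynomial rings `L[x;σ]` and the quotients `L[x;σ] / (F(x^n))`. -/

section SkewPoly

variable {K L : Type*} [Field K] [Field L] [Algebra K L]

/-- The action of `ℕ` (written multiplicatively) on `L` in which `i` acts as `σ ^ i`. -/
@[reducible] def skewAction (σ : L ≃ₐ[K] L) : MulSemiringAction (Multiplicative ℕ) L :=
  MulSemiringAction.compHom L (powersHom (L ≃ₐ[K] L) σ)

/-- The skew polynomial ring `L[x;σ]`: polynomials `∑ aᵢ xⁱ` with coefficients in `L` written on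
the left, and multiplication determined by `x a = σ(a) x`. -/
def SkewPolyRing (_σ : L ≃ₐ[K] L) : Type _ := SkewPolynomial L

namespace SkewPolyRing

noncomputable instance instRing (σ : L ≃ₐ[K] L) : Ring (SkewPolyRing σ) :=
  letI := skewAction σ
  inferInstanceAs (Ring (SkewPolynomial L))

/-- The coefficient of `xⁱ`. -/
def coeff {σ : L ≃ₐ[K] L} (a : SkewPolyRing σ) (i : ℕ) : L :=
  SkewPolynomial.coeff (R := L) a i

/-- The degree of a skew polynomial, with `deg 0 = ⊥`. -/
def degree {σ : L ≃ₐ[K] L} (a : SkewPolyRing σ) : WithBot ℕ :=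
  (SkewPolynomial.support (R := L) a).max

/-- Constant skew polynomials. -/
noncomputable def C (σ : L ≃ₐ[K] L) : L →+* SkewPolyRing σ :=
  letI := skewAction σ
  SkewPolynomial.CRingHom (R := L)

/-- The indeterminate `x`. -/
noncomputable def X (σ : L ≃ₐ[K] L) : SkewPolyRing σ := SkewPolynomial.X (R := L)

theorem X_mul_C (σ : L ≃ₐ[K] L) (a : L) : X σ * C σ a = C σ (σ a) * X σ := by
  let := skewAction σ
  have h : (SkewPolynomial.X * SkewPolynomial.C a : SkewPolynomial L)
      = SkewPolynomial.C (σ a) * SkewPolynomial.X := by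
    rw [← SkewPolynomial.monomial_zero_left, SkewPolynomial.X_mul_monomial,
      ← SkewPolynomial.monomial_zero_left, SkewPolynomial.monomial_mul_X]
    rfl
  exact h

theorem monomial_eq (σ : L ≃ₐ[K] L) (i : ℕ) (r : L) :
    (SkewPolynomial.monomial i r : SkewPolynomial L) = (show SkewPolynomial L from C σ r * X σ ^ i) := by
  let := skewAction σ
  have h : (SkewPolynomial.monomial i r : SkewPolynomial L)
      = SkewPolynomial.C r * SkewPolynomial.X ^ i := by
    rw [← SkewPolynomial.monomial_zero_left, SkewPolynomial.monomial_mul_X_pow, zero_add]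
  exact h

theorem X_pow_mul_C (σ : L ≃ₐ[K] L) (i : ℕ) (a : L) :
    X σ ^ i * C σ a = C σ ((σ ^ i) a) * X σ ^ i := by
  induction i generalizing a with
  | zero => simp
  | succ i ih =>
    rw [pow_succ, mul_assoc, X_mul_C, ← mul_assoc, ih, mul_assoc, ← pow_succ, pow_succ σ]
    rfl

/-- An element that commutes with the constants and with `x` is central. -/
theorem commute_of_commute {σ : L ≃ₐ[K] L} {z : SkewPolyRing σ}
    (hC : ∀ r, Commute z (C σ r)) (hX : Commute z (X σ)) (a : SkewPolyRing σ) : Commute z a := by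
  refine SkewPolynomial.induction (R := L) (motive := fun a => Commute z (show SkewPolyRing σ from a))
    a (Commute.zero_right z) ?_
  intro i r q _ _ hq
  have h : Commute z (show SkewPolyRing σ from SkewPolynomial.monomial i r) := by
    rw [monomial_eq σ i r]
    exact (hC r).mul_right (hX.pow_right i)
  exact Commute.add_right h hq

/-- The ring homomorphism `K[y] → L[x;σ]`, `g(y) ↦ g(xⁿ)`, with `n` the order of `σ`. -/
noncomputable def central (σ : L ≃ₐ[K] L) : Polynomial K →+* SkewPolyRing σ :=
  Polynomial.eval₂RingHom' ((C σ).comp (algebraMap K L)) (X σ ^ orderOf σ) fun c => by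
    have h := X_pow_mul_C σ (orderOf σ) (algebraMap K L c)
    rw [pow_orderOf_eq_one] at h
    exact h.symm

theorem central_commute (σ : L ≃ₐ[K] L) (g : Polynomial K) (a : SkewPolyRing σ) :
    Commute (central σ g) a := by
  have h1 : ∀ c : K, central σ (Polynomial.C c) = C σ (algebraMap K L c) := fun c =>
    Polynomial.eval₂_C _ _
  have h2 : central σ Polynomial.X = X σ ^ orderOf σ := Polynomial.eval₂_X _ _
  refine commute_of_commute (fun r => ?_) ?_ a
  · induction g using Polynomial.induction_on' with
    | add p q hp hq => rw [map_add]; exact hp.add_left hq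
    | monomial i c =>
      rw [← Polynomial.C_mul_X_pow_eq_monomial, map_mul, map_pow, h1, h2]
      refine Commute.mul_left ?_ (Commute.pow_left ?_ i)
      · change _ * _ = _ * _
        rw [← map_mul, mul_comm, map_mul]
      · change _ * _ = _ * _
        rw [X_pow_mul_C, pow_orderOf_eq_one]
        rfl
  · induction g using Polynomial.induction_on' with
    | add p q hp hq => rw [map_add]; exact hp.add_left hq
    | monomial i c =>
      rw [← Polynomial.C_mul_X_pow_eq_monomial, map_mul, map_pow, h1, h2]
      refine Commute.mul_left ?_ (((Commute.refl _).pow_left _).pow_left i)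
      change _ * _ = _ * _
      rw [X_mul_C, AlgEquiv.commutes]

/-- The left ideal `R F(xⁿ)` of `R = L[x;σ]`; it is two-sided because `F(xⁿ)` is central. -/
noncomputable abbrev idealOf (σ : L ≃ₐ[K] L) (F : Polynomial K) : Ideal (SkewPolyRing σ) :=
  Ideal.span {central σ F}

instance instIsTwoSided (σ : L ≃ₐ[K] L) (F : Polynomial K) : (idealOf σ F).IsTwoSided := by
  refine ⟨fun {a} b ha => ?_⟩
  obtain ⟨c, rfl⟩ := Ideal.mem_span_singleton'.1 ha
  rw [mul_assoc, (central_commute σ F b).eq, ← mul_assoc]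
  exact Ideal.mem_span_singleton'.2 ⟨_, rfl⟩

/-- The quotient ring `R_F = R / R F(xⁿ)`. -/
abbrev QuotRing (σ : L ≃ₐ[K] L) (F : Polynomial K) : Type _ := SkewPolyRing σ ⧸ idealOf σ F

/-- The image in `R_F` of a skew polynomial. -/
noncomputable abbrev toQuot (σ : L ≃ₐ[K] L) (F : Polynomial K) : SkewPolyRing σ →+* QuotRing σ F :=
  Ideal.Quotient.mk (idealOf σ F)

/-- The ring homomorphism `E = K[y]/(F) → R_F` sending the class of `g(y)` to that of `g(xⁿ)`. -/
noncomputable def scalarHom (σ : L ≃ₐ[K] L) (F : Polynomial K) : AdjoinRoot F →+* QuotRing σ F :=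
  Ideal.Quotient.lift (Ideal.span {F}) ((toQuot σ F).comp (central σ)) (by
    intro g hg
    obtain ⟨c, rfl⟩ := Ideal.mem_span_singleton'.1 hg
    rw [RingHom.comp_apply, map_mul]
    exact Ideal.Quotient.eq_zero_iff_mem.2 (Ideal.mem_span_singleton'.2 ⟨_, rfl⟩))

theorem scalarHom_mk (σ : L ≃ₐ[K] L) (F g : Polynomial K) :
    scalarHom σ F (AdjoinRoot.mk F g) = toQuot σ F (central σ g) := rfl

/-- `R_F` as an algebra over `E = K[y]/(F)`. -/
noncomputable instance instAlgebraQuot (σ : L ≃ₐ[K] L) (F : Polynomial K) :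
    Algebra (AdjoinRoot F) (QuotRing σ F) :=
  RingHom.toAlgebra' (scalarHom σ F) (by
    intro e b
    obtain ⟨g, rfl⟩ := AdjoinRoot.mk_surjective e
    obtain ⟨a, rfl⟩ := Ideal.Quotient.mk_surjective b
    rw [scalarHom_mk, ← map_mul, ← map_mul, (central_commute σ g a).eq])

end SkewPolyRing

end SkewPoly

/-!
Part (0). With trace-dual bases of `L/K` one writes down two-sided multiplications of `R_F` dual to
the spanning family `bⱼ xⁱ`, `i < n`. Hence every `E`-linear endomorphism of `R_F` is a combination
of two-sided multiplications, which makes `R_F` central simple of dimension `n²` over the finite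
field `E`, and Wedderburn's little theorem applies.

Parts (1) and (2). Let `R_F` act on `W = Eⁿ` through `φ`, let `U` be the kernel of `a`, and let
`V = Hom_E(U, W)`, an `L`-space of dimension `s · dim_E U`. Since `R_F` acts on `W` by all
endomorphisms, the inclusion of `U` generates `V` over `R`; it is killed by `a`, so
`dim_L V ≤ deg a`, which is (1). In case of equality `x` acts on `V` as a `σ`-semilinear companion
matrix of `a`, whose determinant over `K` is read off from `N(a₀) / N(a_{sk})`; the same determinant
is `N_{E/K}((det_E x)ᵏ)`, where `det_E x = (-1)ⁿ⁻¹ y`: as `xⁿ = y` and the powers of `x` below `n`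
are independent over `E`, the characteristic polynomial of `x` on `W` is `Tⁿ - y`.
-/

section TraceDual

variable {K L ι : Type*} [Field K] [Field L] [Algebra K L] [FiniteDimensional K L] [IsGalois K L]

theorem sum_apply_mul_apply_traceDual [Fintype ι] [DecidableEq ι]
    [DecidableEq (L ≃ₐ[K] L)] (b : Module.Basis ι K L) (τ τ' : L ≃ₐ[K] L) :
    ∑ j, τ (b j) * τ' (b.traceDual j) = if τ = τ' then 1 else 0 := by
  let M : Matrix (L ≃ₐ[K] L) ι L := .of fun τ j => τ (b j)
  let D : Matrix ι (L ≃ₐ[K] L) L := .of fun j τ => τ (b.traceDual j)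
  have hDM : D * M = 1 := by
    ext i j
    have h := congrArg (algebraMap K L) (b.trace_traceDual_mul i j)
    rw [trace_eq_sum_automorphisms] at h
    simpa [M, D, Matrix.mul_apply, Matrix.one_apply, eq_comm, apply_ite] using h
  have hcard : Fintype.card ι = Fintype.card (L ≃ₐ[K] L) := by
    rw [← Module.finrank_eq_card_basis b, ← IsGalois.card_aut_eq_finrank, Nat.card_eq_fintype_card]
  have hMD : M * D = 1 := (Matrix.mul_eq_one_comm_of_card_eq _ _ _ hcard).1 hDM
  simpa only [M, D, Matrix.mul_apply, Matrix.of_apply, Matrix.one_apply]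
    using congrFun (congrFun hMD τ) τ'

theorem sum_pow_apply_eq_trace {σ : L ≃ₐ[K] L} (hσ : ∀ τ : L ≃ₐ[K] L, τ ∈ Subgroup.zpowers σ)
    (l : L) :
    ∑ i ∈ Finset.range (orderOf σ), (σ ^ i) l = algebraMap K L (Algebra.trace K L l) := by
  classical
  rw [trace_eq_sum_automorphisms, ← IsCyclic.image_range_orderOf hσ, Finset.sum_image]
  simpa using pow_injOn_Iio_orderOf (x := σ)

end TraceDual

section Wedderburn

open TensorProduct

section CommRing

variable {E B : Type*} [CommRing E] [Ring B] [Algebra E B]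

theorem mulLeft_mem_range_mulLeftRight (a : B) :
    LinearMap.mulLeft E a ∈ (AlgHom.mulLeftRight E B).range :=
  ⟨a ⊗ₜ 1, by ext; simp⟩

theorem mulRight_mem_range_mulLeftRight (a : B) :
    LinearMap.mulRight E a ∈ (AlgHom.mulLeftRight E B).range :=
  ⟨1 ⊗ₜ MulOpposite.op a, by ext; simp⟩

theorem mulLeftRight_surjective_of_dual {κ : Type*} [Finite κ] [DecidableEq κ] {g : κ → B}
    (hg : Submodule.span E (Set.range g) = ⊤) {t : κ → Module.End E B}
    (ht : ∀ p, t p ∈ (AlgHom.mulLeftRight E B).range)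
    (htg : ∀ p q, t p (g q) = if p = q then 1 else 0) :
    Function.Surjective (AlgHom.mulLeftRight E B) := by
  have := Fintype.ofFinite κ
  intro f
  have hf : f = ∑ p, LinearMap.mulLeft E (f (g p)) * t p :=
    LinearMap.ext_on_range hg fun q => by simp [LinearMap.sum_apply, htg]
  rw [← AlgHom.mem_range, hf]
  exact sum_mem fun p _ => mul_mem (mulLeft_mem_range_mulLeftRight _) (ht p)

theorem isCentral_of_mulLeftRight_surjective [Module.Free E B]
    (hB : Function.Surjective (AlgHom.mulLeftRight E B)) : Algebra.IsCentral E B := by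
  refine ⟨fun z hz => ?_⟩
  have hcomm : ∀ t : B ⊗[E] Bᵐᵒᵖ, Commute (AlgHom.mulLeftRight E B t) (LinearMap.mulLeft E z) := by
    intro t
    induction t with
    | zero => simp
    | add t₁ t₂ h₁ h₂ => rw [map_add]; exact h₁.add_left h₂
    | tmul a b =>
      refine LinearMap.ext fun w => ?_
      simp [← mul_assoc, Subalgebra.mem_center_iff.1 hz a]
  have hmem : LinearMap.mulLeft E z ∈ Subalgebra.center E (Module.End E B) :=
    Subalgebra.mem_center_iff.2 fun f => by obtain ⟨t, rfl⟩ := hB f; exact hcomm t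
  obtain ⟨e, he⟩ := (Algebra.IsCentral.mem_center_iff E).1 hmem
  exact ⟨e, by simpa [Algebra.algebraMap_eq_smul_one] using (congrArg (· (1 : B)) he).symm⟩

end CommRing

variable {E B : Type*} [Field E] [Ring B] [Algebra E B]

theorem linearIndependent_of_dual [Nontrivial B] {κ : Type*} [DecidableEq κ] {g : κ → B}
    {t : κ → Module.End E B} (htg : ∀ p q, t p (g q) = if p = q then 1 else 0) :
    LinearIndependent E g := by
  refine linearIndependent_iff'.2 fun s e he p hp => ?_
  simpa [htg, hp] using congrArg (t p) he

theorem isSimpleRing_of_mulLeftRight_surjective [Nontrivial B]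
    (hB : Function.Surjective (AlgHom.mulLeftRight E B)) : IsSimpleRing B := by
  refine isSimpleRing_iff_isTwoSided_imp.2 ⟨inferInstance, fun I hI => ?_⟩
  have stable : ∀ t : B ⊗[E] Bᵐᵒᵖ, ∀ w ∈ I, AlgHom.mulLeftRight E B t w ∈ I := by
    intro t w hw
    induction t with
    | zero => simp
    | add t₁ t₂ h₁ h₂ => rw [map_add]; exact I.add_mem h₁ h₂
    | tmul a b =>
      rw [AlgHom.mulLeftRight_apply]
      exact I.mul_mem_right _ (I.mul_mem_left _ hw)
  refine or_iff_not_imp_left.2 fun hbot => ?_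
  obtain ⟨w, hw, hw0⟩ := I.ne_bot_iff.1 hbot
  obtain ⟨f, hf⟩ := Module.Projective.exists_dual_eq_one E hw0
  obtain ⟨t, ht⟩ := hB (f.smulRight 1)
  rw [I.eq_top_iff_one]
  simpa [ht, hf] using stable t w hw

theorem nonempty_algEquiv_matrix_of_finite [Finite E] [Module.Finite E B] [IsSimpleRing B]
    [Algebra.IsCentral E B] {n : ℕ} (hn : Module.finrank E B = n ^ 2) :
    Nonempty (B ≃ₐ[E] Matrix (Fin n) (Fin n) E) := by
  have : IsArtinianRing B := .of_finite E B
  obtain ⟨m, _, D, _, _, _, ⟨e⟩⟩ := IsSimpleRing.exists_algEquiv_matrix_divisionRing_finite E B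
  have : Finite D := Module.finite_of_finite E
  have wedderburn (d d' : D) : d * d' = d' * d := (Finite.isDomain_to_isField D).mul_comm d d'
  have := Algebra.IsCentral.of_algEquiv E B _ e
  have hsurj : Function.Surjective (algebraMap E D) := by
    intro d
    have hd : Matrix.scalar (Fin m) d ∈ Subalgebra.center E (Matrix (Fin m) (Fin m) D) :=
      Subalgebra.mem_center_iff.2 fun A => (Matrix.scalar_commute d (wedderburn d) A).symm
    obtain ⟨t, ht⟩ := (Algebra.IsCentral.mem_center_iff E).1 hd
    exact ⟨t, by simpa [Matrix.algebraMap_matrix_apply] using (congrFun₂ ht 0 0).symm⟩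
  let g : E ≃ₐ[E] D := .ofBijective (Algebra.ofId E D) ⟨(algebraMap E D).injective, hsurj⟩
  let e' : B ≃ₐ[E] Matrix (Fin m) (Fin m) E := e.trans g.symm.mapMatrix
  obtain rfl : m = n := by
    have h := e'.toLinearEquiv.finrank_eq
    rw [hn, Module.finrank_matrix, Module.finrank_self, Fintype.card_fin, mul_one, ← sq] at h
    exact (Nat.pow_left_injective two_ne_zero h).symm
  exact ⟨e'⟩

end Wedderburn

section Semilinear

open Polynomial

variable {K L V : Type*} [Field K] [Field L] [Algebra K L]

theorem orderOf_eq_finrank_of_forall_mem_zpowers [FiniteDimensional K L] [IsGalois K L]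
    {σ : L ≃ₐ[K] L} (hσ : ∀ τ : L ≃ₐ[K] L, τ ∈ Subgroup.zpowers σ) :
    orderOf σ = Module.finrank K L := by
  rw [orderOf_eq_card_of_forall_mem_zpowers hσ, IsGalois.card_aut_eq_finrank]

theorem det_toLinearMap_of_orderOf_eq_finrank [FiniteDimensional K L] {σ : L ≃ₐ[K] L}
    (hσ : orderOf σ = Module.finrank K L) :
    LinearMap.det σ.toLinearMap = (-1) ^ (Module.finrank K L - 1) := by
  have hpos : 0 < Module.finrank K L := Module.finrank_pos
  have hfin : IsOfFinOrder σ := orderOf_pos_iff.mp (hσ ▸ hpos)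
  have hminpoly : minpoly K σ.toLinearMap = X ^ Module.finrank K L - C 1 := by
    rw [minpoly_algEquiv_toLinearMap σ hfin, hσ, C_1]
  have hcharpoly : LinearMap.charpoly σ.toLinearMap = X ^ Module.finrank K L - C 1 := by
    rw [← hminpoly]
    refine eq_of_monic_of_dvd_of_natDegree_le (minpoly.monic (Algebra.IsIntegral.isIntegral _))
      (LinearMap.charpoly_monic _) (LinearMap.minpoly_dvd_charpoly _) ?_
    rw [hminpoly, LinearMap.charpoly_natDegree, natDegree_X_pow_sub_C]
  rw [LinearMap.det_eq_sign_charpoly_coeff, hcharpoly, coeff_sub, coeff_X_pow, if_neg hpos.ne,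
    coeff_C_zero, zero_sub, ← pow_sub_one_mul hpos.ne', mul_assoc, neg_one_mul, neg_neg, mul_one]

theorem algebraNorm_div [FiniteDimensional K L] (x y : L) :
    Algebra.norm K (x / y) = Algebra.norm K x / Algebra.norm K y := by
  rcases eq_or_ne y 0 with rfl | hy
  · simp
  · rw [eq_div_iff (Algebra.norm_ne_zero_iff.2 hy), ← map_mul, div_mul_cancel₀ x hy]

theorem algebraNorm_neg_one_pow_mul [FiniteDimensional K L] (d : ℕ) (x : L) :
    Algebra.norm K ((-1) ^ d * x) = (-1) ^ (Module.finrank K L * d) * Algebra.norm K x := by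
  rw [map_mul, map_pow, ← map_one (algebraMap K L), ← map_neg, Algebra.norm_algebraMap, pow_mul]

variable [AddCommGroup V] [Module K V] [Module L V] {σ : L ≃ₐ[K] L} {f : V →ₗ[K] V}

theorem pow_smul_of_semilinear (hf : ∀ (l : L) w, f (l • w) = σ l • f w) (i : ℕ) (l : L) (w : V) :
    (f ^ i) (l • w) = (σ ^ i) l • (f ^ i) w := by
  induction i with
  | zero => simp
  | succ i ih => rw [pow_succ', pow_succ', Module.End.mul_apply, ih, hf]; rfl

theorem span_iterates_eq_top_of_semilinear_relation (hf : ∀ (l : L) w, f (l • w) = σ l • f w)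
    {v : V} (hv : Submodule.span L (Set.range fun i : ℕ => (f ^ i) v) = ⊤) {d : ℕ} {a : ℕ → L}
    (had : a d ≠ 0) (ha : ∑ i ∈ Finset.range (d + 1), a i • (f ^ i) v = 0) :
    Submodule.span L (Set.range fun i : Fin d => (f ^ (i : ℕ)) v) = ⊤ := by
  rw [eq_top_iff, ← hv, Submodule.span_le]
  rintro _ ⟨m, rfl⟩
  induction m using Nat.strong_induction_on with
  | _ m ih =>
    rcases lt_or_ge m d with hm | hm
    · exact Submodule.subset_span ⟨⟨m, hm⟩, rfl⟩
    obtain ⟨j, rfl⟩ := Nat.exists_eq_add_of_le' hm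
    have shifted : ∑ i ∈ Finset.range (d + 1), (σ ^ j) (a i) • (f ^ (j + i)) v = 0 := by
      simpa only [map_sum, map_zero, pow_smul_of_semilinear hf, ← Module.End.mul_apply, ← pow_add]
        using congrArg (f ^ j) ha
    rw [Finset.sum_range_succ] at shifted
    rw [SetLike.mem_coe, ← Submodule.smul_mem_iff _ ((map_ne_zero (σ ^ j)).2 had),
      eq_neg_of_add_eq_zero_right shifted]
    refine Submodule.neg_mem _ (Submodule.sum_mem _ fun i hi => Submodule.smul_mem _ _ ?_)
    exact ih (j + i) (by have := Finset.mem_range.1 hi; omega)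

theorem finrank_le_of_semilinear_relation (hf : ∀ (l : L) w, f (l • w) = σ l • f w)
    {v : V} (hv : Submodule.span L (Set.range fun i : ℕ => (f ^ i) v) = ⊤) {d : ℕ} {a : ℕ → L}
    (had : a d ≠ 0) (ha : ∑ i ∈ Finset.range (d + 1), a i • (f ^ i) v = 0) :
    Module.finrank L V ≤ d := by
  rw [← finrank_top, ← span_iterates_eq_top_of_semilinear_relation hf hv had ha]
  exact (finrank_range_le_card _).trans_eq (Fintype.card_fin d)

theorem det_of_cyclic_relation {d : ℕ} (b : Module.Basis (Fin d) L V) {T : Module.End L V} {v : V}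
    (hb : ∀ i, b i = (T ^ (i : ℕ)) v) {a : ℕ → L} (had : a d ≠ 0)
    (ha : ∑ i ∈ Finset.range (d + 1), a i • (T ^ i) v = 0) :
    LinearMap.det T = (-1) ^ d * (a 0 / a d) := by
  have : Module.Finite L V := .of_basis b
  have hrank : Module.finrank L V = d := by rw [Module.finrank_eq_card_basis b, Fintype.card_fin]
  have hlead : T.charpoly.coeff d = 1 := by
    rw [← T.charpoly_monic.coeff_natDegree, LinearMap.charpoly_natDegree, hrank]
  have cayleyHamilton : ∑ i ∈ Finset.range (d + 1), T.charpoly.coeff i • (T ^ i) v = 0 := by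
    have h := congrArg (· v) T.aeval_self_charpoly
    rw [aeval_eq_sum_range, LinearMap.charpoly_natDegree, hrank] at h
    simpa only [LinearMap.sum_apply, LinearMap.smul_apply, LinearMap.zero_apply] using h
  have hcoeff : ∀ i < d, a d * T.charpoly.coeff i = a i := by
    have hdiff : ∑ i : Fin d, (a d * T.charpoly.coeff i - a i) • b i = 0 := by
      have h := congrArg₂ (a d • · - ·) cayleyHamilton ha
      simpa only [Finset.sum_range_succ, hlead, one_smul, smul_add, Finset.smul_sum, smul_smul,
        add_sub_add_right_eq_sub, ← Finset.sum_sub_distrib, ← sub_smul, smul_zero, sub_zero,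
        Finset.sum_range, hb] using h
    intro i hi
    exact sub_eq_zero.1 (Fintype.linearIndependent_iff.1 b.linearIndependent _ hdiff ⟨i, hi⟩)
  rw [LinearMap.det_eq_sign_charpoly_coeff, hrank]
  congr 1
  rcases d.eq_zero_or_pos with rfl | hd
  · rw [hlead, div_self had]
  · rw [← hcoeff 0 hd, mul_div_cancel_left₀ _ had]

variable [IsScalarTower K L V]

theorem det_of_apply_basis_eq [FiniteDimensional K L] {ι : Type*} [Fintype ι]
    (b : Module.Basis ι L V) (hf : ∀ (l : L) w, f (l • w) = σ l • f w)
    {T : Module.End L V} (hT : ∀ i, T (b i) = f (b i)) :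
    LinearMap.det f =
      Algebra.norm K (LinearMap.det T) * LinearMap.det σ.toLinearMap ^ Fintype.card ι := by
  let e : (ι → L) ≃ₗ[K] V := b.equivFun.symm.restrictScalars K
  let S : (ι → L) →ₗ[K] (ι → L) := LinearMap.pi fun i => σ.toLinearMap ∘ₗ LinearMap.proj i
  have hfac : f = T.restrictScalars K ∘ₗ (e : (ι → L) →ₗ[K] V) ∘ₗ S ∘ₗ e.symm := by
    ext w
    obtain ⟨c, rfl⟩ := e.surjective w
    have he : ∀ c, e c = ∑ i, c i • b i := b.equivFun_symm_apply
    simp only [LinearMap.comp_apply, LinearEquiv.coe_coe, LinearEquiv.symm_apply_apply,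
      LinearMap.restrictScalars_apply]
    simp only [he, map_sum, hf, map_smul, hT]
    rfl
  rw [hfac, LinearMap.det_comp, LinearMap.det_conj, LinearMap.det_restrictScalars,
    LinearMap.det_pi, Finset.prod_const, Finset.card_univ]

theorem det_of_semilinear_relation [FiniteDimensional K L] (hσ : orderOf σ = Module.finrank K L)
    (hf : ∀ (l : L) w, f (l • w) = σ l • f w)
    {v : V} (hv : Submodule.span L (Set.range fun i : ℕ => (f ^ i) v) = ⊤) {d : ℕ} {a : ℕ → L}
    (had : a d ≠ 0) (ha : ∑ i ∈ Finset.range (d + 1), a i • (f ^ i) v = 0)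
    (hd : Module.finrank L V = d) :
    LinearMap.det f = (-1) ^ d * (Algebra.norm K (a 0) / Algebra.norm K (a d)) := by
  have hspan := span_iterates_eq_top_of_semilinear_relation hf hv had ha
  let b : Module.Basis (Fin d) L V := basisOfTopLeSpanOfCardEqFinrank _ hspan.ge (by simp [hd])
  have hb : ∀ i, b i = (f ^ (i : ℕ)) v := fun i => by simp [b]
  let T : Module.End L V := b.constr L fun i => f (b i)
  have hT : ∀ i, T (b i) = f (b i) := b.constr_basis L _
  have hTpow : ∀ i ≤ d, (T ^ i) v = (f ^ i) v := by
    intro i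
    induction i with
    | zero => simp
    | succ i ih =>
      intro hi
      rw [pow_succ', Module.End.mul_apply, ih (by omega), ← hb ⟨i, hi⟩, hT, hb,
        ← Module.End.mul_apply, ← pow_succ']
  have hdetT : LinearMap.det T = (-1) ^ d * (a 0 / a d) :=
    det_of_cyclic_relation b (fun i => (hb i).trans (hTpow i i.2.le).symm) had <| by
      rw [← ha]
      refine Finset.sum_congr rfl fun i hi => ?_
      rw [hTpow i (Finset.mem_range_succ_iff.1 hi)]
  have hparity : Even (Module.finrank K L * d + (Module.finrank K L - 1) * d + d) := by
    obtain ⟨m, hm⟩ := Nat.exists_eq_succ_of_ne_zero (Module.finrank_pos (R := K) (M := L)).ne'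
    exact ⟨(m + 1) * d, by rw [hm, Nat.succ_eq_add_one, Nat.add_sub_cancel]; ring⟩
  rw [det_of_apply_basis_eq b hf hT, hdetT, algebraNorm_neg_one_pow_mul,
    det_toLinearMap_of_orderOf_eq_finrank hσ, Fintype.card_fin, algebraNorm_div, ← pow_mul]
  rw [mul_right_comm, ← pow_add]
  congr 1
  exact neg_one_pow_congr (by grind)

end Semilinear

section CyclicAlgebra

open Polynomial

variable {K L : Type*} [Field K] [Field L] [Algebra K L]

/-- The relations of a cyclic algebra over `E`: a copy `c` of `L` in `B`, compatible with the
scalars of `K`, and an element `x` that induces `σ` on it and whose `n`-th power, with `n` the order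
of `σ`, is the scalar `y`. Nothing is said about `c` and `x` generating `B`. -/
structure IsCyclicPair {E B : Type*} [CommRing E] [Algebra K E] [Ring B] [Algebra E B]
    (σ : L ≃ₐ[K] L) (c : L →+* B) (x : B) (y : E) : Prop where
  map_algebraMap : ∀ r : K, c (algebraMap K L r) = algebraMap E B (algebraMap K E r)
  mul_map : ∀ l : L, x * c l = c (σ l) * x
  pow_orderOf : x ^ orderOf σ = algebraMap E B y

namespace IsCyclicPair

variable {E B : Type*} [CommRing E] [Ring B] [Algebra E B] {σ : L ≃ₐ[K] L} {c : L →+* B}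

/-- The two-sided multiplication that keeps the term in `xᵐ` of a polynomial in `x` of degree less
than the order of `σ` and kills the other terms; see `IsCyclicPair.isolate_apply`. -/
noncomputable def isolate [FiniteDimensional K L] [IsGalois K L] {ι : Type*} [Fintype ι]
    [DecidableEq ι] (E : Type*) [CommRing E] [Algebra E B] (σ : L ≃ₐ[K] L) (c : L →+* B)
    (b : Module.Basis ι K L) (m : ℕ) : Module.End E B :=
  ∑ j, LinearMap.mulLeft E (c ((σ ^ m) (b.traceDual j))) * LinearMap.mulRight E (c (b j))

theorem isolate_mem_range_mulLeftRight [FiniteDimensional K L] [IsGalois K L] {ι : Type*}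
    [Fintype ι] [DecidableEq ι] (b : Module.Basis ι K L) (m : ℕ) :
    isolate E σ c b m ∈ (AlgHom.mulLeftRight E B).range :=
  sum_mem fun _ _ =>
    mul_mem (mulLeft_mem_range_mulLeftRight _) (mulRight_mem_range_mulLeftRight _)

variable [Algebra K E] {x : B} {y : E}

theorem pow_mul_map (h : IsCyclicPair σ c x y) (i : ℕ) (l : L) :
    x ^ i * c l = c ((σ ^ i) l) * x ^ i := by
  induction i generalizing l with
  | zero => simp
  | succ i ih => rw [pow_succ, mul_assoc, h.mul_map, ← mul_assoc, ih, mul_assoc, pow_succ σ]; rfl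

theorem isUnit (h : IsCyclicPair σ c x y) (hσ : orderOf σ ≠ 0) (hy : IsUnit y) : IsUnit x := by
  rw [← isUnit_pow_iff hσ, h.pow_orderOf]
  exact hy.map (algebraMap E B)

theorem map_smul (h : IsCyclicPair σ c x y) (r : K) (l : L) :
    c (r • l) = algebraMap K E r • c l := by
  rw [Algebra.smul_def, map_mul, h.map_algebraMap, ← Algebra.smul_def]

theorem span_eq_top (h : IsCyclicPair σ c x y) (hσ : orderOf σ ≠ 0)
    (hgen : ∀ w, ∃ (d : ℕ) (a : ℕ → L), w = ∑ i ∈ Finset.range d, c (a i) * x ^ i)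
    {ι : Type*} [Finite ι] (b : Module.Basis ι K L) :
    Submodule.span E (Set.range fun p : Fin (orderOf σ) × ι => c (b p.2) * x ^ (p.1 : ℕ)) = ⊤ := by
  have := Fintype.ofFinite ι
  refine eq_top_iff.2 fun w _ => ?_
  obtain ⟨d, a, rfl⟩ := hgen w
  refine Submodule.sum_mem _ fun i _ => ?_
  have hreduce : c (a i) * x ^ i = ∑ j, (algebraMap K E (b.repr (a i) j) * y ^ (i / orderOf σ)) •
      (c (b j) * x ^ (i % orderOf σ)) := by
    have hpow : x ^ i = y ^ (i / orderOf σ) • x ^ (i % orderOf σ) := by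
      conv_lhs => rw [← Nat.div_add_mod i (orderOf σ), pow_add, pow_mul, h.pow_orderOf, ← map_pow,
        ← Algebra.smul_def]
    conv_lhs => rw [hpow, mul_smul_comm, ← b.sum_repr (a i), map_sum, Finset.sum_mul,
      Finset.smul_sum]
    refine Finset.sum_congr rfl fun j _ => ?_
    rw [h.map_smul, smul_mul_assoc, smul_smul, mul_comm]
  rw [hreduce]
  exact Submodule.sum_mem _ fun j _ => Submodule.smul_mem _ _
    (Submodule.subset_span ⟨(⟨i % orderOf σ, Nat.mod_lt _ (Nat.pos_of_ne_zero hσ)⟩, j), rfl⟩)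

variable [FiniteDimensional K L] [IsGalois K L]

theorem isolate_apply (h : IsCyclicPair σ c x y) {ι : Type*} [Fintype ι] [DecidableEq ι]
    (b : Module.Basis ι K L) (l : L) {i m : ℕ} (hi : i < orderOf σ) (hm : m < orderOf σ) :
    isolate E σ c b m (c l * x ^ i) = if i = m then c l * x ^ i else 0 := by
  classical
  have hterm : isolate E σ c b m (c l * x ^ i) =
      c (l * ∑ j, (σ ^ i) (b j) * (σ ^ m) (b.traceDual j)) * x ^ i := by
    simp only [isolate, LinearMap.sum_apply, Module.End.mul_apply, LinearMap.mulLeft_apply,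
      LinearMap.mulRight_apply, Finset.mul_sum, map_sum, Finset.sum_mul]
    refine Finset.sum_congr rfl fun j _ => ?_
    rw [mul_assoc (c l), h.pow_mul_map, ← mul_assoc, ← mul_assoc, ← map_mul, ← map_mul]
    congr 2
    ring
  have hinj : σ ^ i = σ ^ m ↔ i = m := (pow_injOn_Iio_orderOf (x := σ)).eq_iff hi hm
  rw [hterm, sum_apply_mul_apply_traceDual]
  simp only [hinj]
  split_ifs <;> simp

theorem sum_pow_mul_map_mul_inv_pow (h : IsCyclicPair σ c x y)
    (hσ : ∀ τ : L ≃ₐ[K] L, τ ∈ Subgroup.zpowers σ) {u : B} (hu : x * u = 1) (l : L) :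
    ∑ i ∈ Finset.range (orderOf σ), x ^ i * c l * u ^ i =
      algebraMap E B (algebraMap K E (Algebra.trace K L l)) := by
  rw [← h.map_algebraMap, ← sum_pow_apply_eq_trace hσ, map_sum]
  refine Finset.sum_congr rfl fun i _ => ?_
  rw [h.pow_mul_map, mul_assoc, pow_mul_pow_eq_one i hu, mul_one]

theorem exists_dual (h : IsCyclicPair σ c x y) (hσ : ∀ τ : L ≃ₐ[K] L, τ ∈ Subgroup.zpowers σ)
    (hy : IsUnit y) {ι : Type*} [Finite ι] [DecidableEq ι] (b : Module.Basis ι K L) :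
    ∃ t : Fin (orderOf σ) × ι → Module.End E B,
      (∀ p, t p ∈ (AlgHom.mulLeftRight E B).range) ∧
      ∀ p q, t p (c (b q.2) * x ^ (q.1 : ℕ)) = if p = q then 1 else 0 := by
  have := Fintype.ofFinite ι
  obtain ⟨u, hxu, -⟩ := isUnit_iff_exists.1 (h.isUnit (orderOf_pos σ).ne' hy)
  let traceMap : Module.End E B :=
    ∑ i ∈ Finset.range (orderOf σ), LinearMap.mulLeft E (x ^ i) * LinearMap.mulRight E (u ^ i)
  have hmem : traceMap ∈ (AlgHom.mulLeftRight E B).range := sum_mem fun _ _ =>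
    mul_mem (mulLeft_mem_range_mulLeftRight _) (mulRight_mem_range_mulLeftRight _)
  have htrace (l : L) : traceMap (c l) = algebraMap E B (algebraMap K E (Algebra.trace K L l)) := by
    simp only [← h.sum_pow_mul_map_mul_inv_pow hσ hxu, traceMap, LinearMap.sum_apply,
      Module.End.mul_apply, LinearMap.mulLeft_apply, LinearMap.mulRight_apply, mul_assoc]
  -- Isolate the term in `xᵐ`, strip `xᵐ` with its inverse `uᵐ`, then pair with the dual basis.
  refine ⟨fun p => traceMap * LinearMap.mulRight E (c (b.traceDual p.2)) *
    LinearMap.mulRight E (u ^ (p.1 : ℕ)) * isolate E σ c b p.1, fun p => ?_, fun p q => ?_⟩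
  · exact mul_mem (mul_mem (mul_mem hmem (mulRight_mem_range_mulLeftRight _))
      (mulRight_mem_range_mulLeftRight _)) (isolate_mem_range_mulLeftRight b p.1)
  · obtain ⟨m, j⟩ := p
    obtain ⟨i, j'⟩ := q
    simp only [Module.End.mul_apply, h.isolate_apply b _ i.2 m.2, LinearMap.mulRight_apply,
      Fin.val_inj, Prod.mk.injEq]
    rcases eq_or_ne i m with rfl | hi
    · rw [if_pos rfl, mul_assoc (c _), pow_mul_pow_eq_one _ hxu, mul_one, ← map_mul, htrace,
        b.trace_mul_traceDual]
      rcases eq_or_ne j' j with rfl | hj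
      · rw [if_pos rfl, if_pos ⟨rfl, rfl⟩, map_one, map_one]
      · rw [if_neg hj, if_neg fun hjj => hj hjj.2.symm, map_zero, map_zero]
    · rw [if_neg hi, if_neg fun hmj => hi hmj.1.symm, zero_mul, zero_mul, map_zero]

end IsCyclicPair

theorem IsCyclicPair.nonempty_algEquiv_matrix [FiniteDimensional K L] [IsGalois K L]
    {E B : Type*} [Field E] [Finite E] [Algebra K E] [Ring B] [Nontrivial B] [Algebra E B]
    {σ : L ≃ₐ[K] L} {c : L →+* B} {x : B} {y : E} (h : IsCyclicPair σ c x y)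
    (hσ : ∀ τ : L ≃ₐ[K] L, τ ∈ Subgroup.zpowers σ) (hy : y ≠ 0)
    (hgen : ∀ w, ∃ (d : ℕ) (a : ℕ → L), w = ∑ i ∈ Finset.range d, c (a i) * x ^ i) :
    Nonempty (B ≃ₐ[E] Matrix (Fin (Module.finrank K L)) (Fin (Module.finrank K L)) E) := by
  let b := Module.finBasis K L
  obtain ⟨t, ht, htg⟩ := h.exists_dual hσ hy.isUnit b
  have hspan := h.span_eq_top (orderOf_pos σ).ne' hgen b
  have hsurj := mulLeftRight_surjective_of_dual hspan ht htg
  let basis := Module.Basis.mk (linearIndependent_of_dual htg) hspan.ge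
  have := isSimpleRing_of_mulLeftRight_surjective hsurj
  have := isCentral_of_mulLeftRight_surjective hsurj
  have : Module.Finite E B := .of_basis basis
  refine nonempty_algEquiv_matrix_of_finite ?_
  rw [Module.finrank_eq_card_basis basis, Fintype.card_prod, Fintype.card_fin, Fintype.card_fin,
    orderOf_eq_finrank_of_forall_mem_zpowers hσ, sq]

theorem IsCyclicPair.det_eq [FiniteDimensional K L] [IsGalois K L] {E W : Type*} [Field E]
    [Algebra K E] [AddCommGroup W] [Module E W] {σ : L ≃ₐ[K] L} {c : L →+* Module.End E W}
    {x : Module.End E W} {y : E} (h : IsCyclicPair σ c x y) (hσ : orderOf σ = Module.finrank K L)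
    (hW : Module.finrank E W = Module.finrank K L) :
    LinearMap.det x = (-1) ^ (Module.finrank K L - 1) * y := by
  have hpos : 0 < Module.finrank K L := Module.finrank_pos
  have : Module.Finite E W := Module.finite_of_finrank_pos (hW ▸ hpos)
  have : Nontrivial W := Module.nontrivial_of_finrank_pos (R := E) (hW ▸ hpos)
  have hlead : x.charpoly.coeff (Module.finrank K L) = 1 := by
    rw [← x.charpoly_monic.coeff_natDegree, LinearMap.charpoly_natDegree, hW]
  have relation : ∑ i ∈ Finset.range (Module.finrank K L), x.charpoly.coeff i • (c 1 * x ^ i) =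
      -(y • 1) := by
    have cayleyHamilton := x.aeval_self_charpoly
    rw [aeval_eq_sum_range, LinearMap.charpoly_natDegree, hW, Finset.sum_range_succ, hlead,
      one_smul, ← hσ, h.pow_orderOf, hσ, Algebra.algebraMap_eq_smul_one] at cayleyHamilton
    simpa only [map_one, one_mul] using eq_neg_of_add_eq_zero_left cayleyHamilton
  have constantTerm : x.charpoly.coeff 0 = -y := by
    let b := Module.finBasis K L
    have isolated := congrArg (isolate E σ c b 0) relation
    have hone := h.isolate_apply b 1 (hσ ▸ hpos) (hσ ▸ hpos)
    rw [map_one, pow_zero, one_mul, if_pos rfl] at hone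
    rw [map_neg, _root_.map_smul, hone, map_sum, Finset.sum_eq_single_of_mem 0
      (Finset.mem_range.2 hpos), _root_.map_smul, map_one, pow_zero, one_mul, hone, ← neg_smul]
      at isolated
    · exact smul_left_injective E one_ne_zero isolated
    · intro i hi hi0
      rw [_root_.map_smul, h.isolate_apply b 1 (hσ ▸ Finset.mem_range.1 hi) (hσ ▸ hpos),
        if_neg hi0, smul_zero]
  rw [LinearMap.det_eq_sign_charpoly_coeff, hW, constantTerm, ← pow_sub_one_mul hpos.ne']
  ring

end CyclicAlgebra

section Hom

theorem det_compRight {R M W : Type*} [CommRing R] [Nontrivial R] [AddCommGroup M] [Module R M]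
    [Module.Free R M] [Module.Finite R M] [AddCommGroup W] [Module R W] [Module.Free R W]
    [Module.Finite R W] (x : Module.End R W) :
    LinearMap.det (x.compRight R : (M →ₗ[R] W) →ₗ[R] M →ₗ[R] W) =
      LinearMap.det x ^ Module.finrank R M := by
  let b := Module.finBasis R M
  let e : (Fin (Module.finrank R M) → W) ≃ₗ[R] (M →ₗ[R] W) := b.constr R
  let S : (Fin (Module.finrank R M) → W) →ₗ[R] Fin (Module.finrank R M) → W :=
    LinearMap.pi fun i => x ∘ₗ LinearMap.proj i
  have hconj : (x.compRight R : (M →ₗ[R] W) →ₗ[R] M →ₗ[R] W) =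
      (e : _ →ₗ[R] M →ₗ[R] W) ∘ₗ S ∘ₗ e.symm := by
    ext f m
    obtain ⟨w, rfl⟩ := e.surjective f
    simp [e, S, Module.Basis.constr_apply_fintype]
  rw [hconj, LinearMap.det_conj, LinearMap.det_pi, Finset.prod_const, Finset.card_univ,
    Fintype.card_fin]

variable {K L E M W : Type*} [Field K] [Field E] [Algebra K E] [AddCommGroup M] [Module E M]
  [AddCommGroup W] [Module K W] [Module E W] [IsScalarTower K E W]

theorem compRight_pow_apply (x : Module.End E W) (i : ℕ) (f : M →ₗ[E] W) :
    ((x.compRight K : Module.End K (M →ₗ[E] W)) ^ i) f = (x ^ i) ∘ₗ f := by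
  induction i with
  | zero => rfl
  | succ i ih => rw [pow_succ', Module.End.mul_apply, ih, pow_succ' x]; rfl

variable [Field L] [Module L W] [SMulCommClass E L W]

theorem sum_smul_compRight_pow_apply (x : Module.End E W) (d : ℕ) (a : ℕ → L) (f : M →ₗ[E] W) :
    ∑ i ∈ Finset.range d, a i • ((x.compRight K : Module.End K (M →ₗ[E] W)) ^ i) f =
      (∑ i ∈ Finset.range d, a i • x ^ i) ∘ₗ f := by
  simp only [compRight_pow_apply]
  ext m
  simp only [LinearMap.comp_apply, LinearMap.sum_apply, LinearMap.smul_apply]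

theorem span_compRight_pow_subtype_eq_top (U : Submodule E W) {x : Module.End E W}
    (hgen : ∀ g : Module.End E W, ∃ (d : ℕ) (a : ℕ → L), g = ∑ i ∈ Finset.range d, a i • x ^ i) :
    Submodule.span L (Set.range fun i : ℕ =>
      ((x.compRight K : Module.End K (U →ₗ[E] W)) ^ i) U.subtype) = ⊤ := by
  refine eq_top_iff.2 fun f _ => ?_
  obtain ⟨g, rfl⟩ := f.exists_extend
  obtain ⟨d, a, rfl⟩ := hgen g
  rw [← sum_smul_compRight_pow_apply (K := K)]
  exact Submodule.sum_mem _ fun i _ => Submodule.smul_mem _ _ (Submodule.subset_span ⟨i, rfl⟩)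

variable [Algebra K L] {σ : L ≃ₐ[K] L} {x : Module.End E W}

theorem compRight_smul_of_semilinear (hx : ∀ (l : L) w, x (l • w) = σ l • x w) (l : L)
    (f : M →ₗ[E] W) : x.compRight K (l • f) = σ l • x.compRight K f := by
  ext m
  simp only [LinearMap.compRight_apply, LinearMap.comp_apply, LinearMap.smul_apply, hx]

variable [FiniteDimensional K L] [FiniteDimensional K E] [IsScalarTower K L W]

theorem finrank_hom_of_finrank_eq [FiniteDimensional E M]
    (hW : Module.finrank E W = Module.finrank K L) :
    Module.finrank L (M →ₗ[E] W) = Module.finrank K E * Module.finrank E M := by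
  have hpos : 0 < Module.finrank K L := Module.finrank_pos
  have : Module.Finite E W := Module.finite_of_finrank_pos (hW ▸ hpos)
  refine Nat.eq_of_mul_eq_mul_left hpos ?_
  rw [Module.finrank_mul_finrank K L, ← Module.finrank_mul_finrank K E (M →ₗ[E] W),
    Module.finrank_linearMap, hW]
  ring

variable {d : ℕ} {a : ℕ → L}

theorem finrank_mul_finrank_ker_le (hW : Module.finrank E W = Module.finrank K L)
    (hx : ∀ (l : L) w, x (l • w) = σ l • x w)
    (hgen : ∀ g : Module.End E W, ∃ (d : ℕ) (a : ℕ → L), g = ∑ i ∈ Finset.range d, a i • x ^ i)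
    (had : a d ≠ 0) :
    Module.finrank K E *
      Module.finrank E (LinearMap.ker (∑ i ∈ Finset.range (d + 1), a i • x ^ i)) ≤ d := by
  have : Module.Finite E W := Module.finite_of_finrank_pos (hW ▸ Module.finrank_pos)
  rw [← finrank_hom_of_finrank_eq hW]
  refine finrank_le_of_semilinear_relation (f := x.compRight K) (v := Submodule.subtype _)
    (compRight_smul_of_semilinear hx) (span_compRight_pow_subtype_eq_top (K := K) _ hgen) had ?_
  rw [sum_smul_compRight_pow_apply, LinearMap.comp_ker_subtype]

theorem norm_det_pow_finrank_ker (hσ : orderOf σ = Module.finrank K L)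
    (hW : Module.finrank E W = Module.finrank K L)
    (hx : ∀ (l : L) w, x (l • w) = σ l • x w)
    (hgen : ∀ g : Module.End E W, ∃ (d : ℕ) (a : ℕ → L), g = ∑ i ∈ Finset.range d, a i • x ^ i)
    (had : a d ≠ 0) (hker : Module.finrank K E *
      Module.finrank E (LinearMap.ker (∑ i ∈ Finset.range (d + 1), a i • x ^ i)) = d) :
    Algebra.norm K (LinearMap.det x ^
      Module.finrank E (LinearMap.ker (∑ i ∈ Finset.range (d + 1), a i • x ^ i))) =
      (-1) ^ d * (Algebra.norm K (a 0) / Algebra.norm K (a d)) := by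
  have : Module.Finite E W := Module.finite_of_finrank_pos (hW ▸ Module.finrank_pos)
  let U := LinearMap.ker (∑ i ∈ Finset.range (d + 1), a i • x ^ i)
  rw [← det_compRight, ← LinearMap.det_restrictScalars]
  refine det_of_semilinear_relation (f := x.compRight K) (v := U.subtype) hσ
    (compRight_smul_of_semilinear hx) (span_compRight_pow_subtype_eq_top _ hgen) had ?_
    ((finrank_hom_of_finrank_eq hW).trans hker)
  rw [sum_smul_compRight_pow_apply, LinearMap.comp_ker_subtype]

end Hom

section CyclicEnd

variable {K L E W : Type*} [Field K] [Field L] [Algebra K L] [Field E] [Algebra K E]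
  [AddCommGroup W] [Module E W] {σ : L ≃ₐ[K] L} {c : L →+* Module.End E W} {x : Module.End E W}
  {y : E}

namespace IsCyclicPair

theorem exists_module (h : IsCyclicPair σ c x y) :
    ∃ (_ : Module K W) (_ : Module L W) (_ : SMulCommClass E L W), IsScalarTower K E W ∧
      IsScalarTower K L W ∧ (∀ (l : L) w, x (l • w) = σ l • x w) ∧
      ∀ (d : ℕ) (a : ℕ → L), ∑ i ∈ Finset.range d, c (a i) * x ^ i =
        ∑ i ∈ Finset.range d, a i • x ^ i := by
  let : Module L W := .compHom W c
  let : Module K W := .compHom W (algebraMap K E)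
  exact ⟨inferInstance, inferInstance, ⟨fun e l w => ((c l).map_smul e w).symm⟩,
    .of_algebraMap_smul fun _ _ => rfl,
    .of_algebraMap_smul fun r w => congrArg (· w) (h.map_algebraMap r),
    fun l w => congrArg (· w) (h.mul_map l), fun _ _ => rfl⟩

variable [FiniteDimensional K L] [FiniteDimensional K E] {d : ℕ} {a : ℕ → L}

theorem finrank_mul_finrank_ker_le (h : IsCyclicPair σ c x y)
    (hW : Module.finrank E W = Module.finrank K L)
    (hgen : ∀ g, ∃ (d : ℕ) (a : ℕ → L), g = ∑ i ∈ Finset.range d, c (a i) * x ^ i)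
    (had : a d ≠ 0) :
    Module.finrank K E *
      Module.finrank E (LinearMap.ker (∑ i ∈ Finset.range (d + 1), c (a i) * x ^ i)) ≤ d := by
  obtain ⟨_, _, _, _, _, hx, hsum⟩ := h.exists_module
  simp only [hsum] at hgen
  rw [hsum]
  exact _root_.finrank_mul_finrank_ker_le hW hx hgen had

theorem norm_det_pow_finrank_ker (h : IsCyclicPair σ c x y) (hσ : orderOf σ = Module.finrank K L)
    (hW : Module.finrank E W = Module.finrank K L)
    (hgen : ∀ g, ∃ (d : ℕ) (a : ℕ → L), g = ∑ i ∈ Finset.range d, c (a i) * x ^ i)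
    (had : a d ≠ 0) (hker : Module.finrank K E *
      Module.finrank E (LinearMap.ker (∑ i ∈ Finset.range (d + 1), c (a i) * x ^ i)) = d) :
    Algebra.norm K (LinearMap.det x ^
      Module.finrank E (LinearMap.ker (∑ i ∈ Finset.range (d + 1), c (a i) * x ^ i))) =
      (-1) ^ d * (Algebra.norm K (a 0) / Algebra.norm K (a d)) := by
  obtain ⟨_, _, _, _, _, hx, hsum⟩ := h.exists_module
  simp only [hsum] at hgen
  rw [hsum] at hker ⊢
  exact _root_.norm_det_pow_finrank_ker hσ hW hx hgen had hker

end IsCyclicPair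

end CyclicEnd

section SkewPolynomialQuotient

open Polynomial

theorem norm_adjoinRoot_root {K : Type*} [Field K] {F : K[X]} (hF : F.Monic) :
    Algebra.norm K (AdjoinRoot.root F) = (-1) ^ F.natDegree * F.coeff 0 := by
  rw [← AdjoinRoot.powerBasis_gen hF.ne_zero, Algebra.PowerBasis.norm_gen_eq_coeff_zero_minpoly,
    AdjoinRoot.powerBasis_gen, AdjoinRoot.powerBasis_dim, AdjoinRoot.minpoly_root hF.ne_zero,
    hF.leadingCoeff, inv_one, C_1, mul_one]

theorem finrank_adjoinRoot {K : Type*} [Field K] {F : K[X]} (hF : F ≠ 0) :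
    Module.finrank K (AdjoinRoot F) = F.natDegree := by
  rw [(AdjoinRoot.powerBasis hF).finrank, AdjoinRoot.powerBasis_dim]

namespace SkewPolyRing

variable {K L : Type*} [Field K] [Field L] [Algebra K L] {σ : L ≃ₐ[K] L}

theorem coeff_sum {ι : Type*} (t : Finset ι) (f : ι → SkewPolyRing σ) (m : ℕ) :
    (∑ i ∈ t, f i).coeff m = ∑ i ∈ t, (f i).coeff m :=
  map_sum (AddMonoidHom.mk' (fun a : SkewPolyRing σ => a.coeff m) fun a b =>
    SkewPolynomial.coeff_add a b m) f t

theorem coeff_C_mul_X_pow (l : L) (i m : ℕ) :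
    (C σ l * X σ ^ i).coeff m = if i = m then l else 0 :=
  (congrArg (coeff · m) (monomial_eq σ i l).symm).trans SkewPolynomial.coeff_monomial

theorem eq_sum_C_mul_X_pow (a : SkewPolyRing σ) {d : ℕ} (hd : ∀ i, d < i → a.coeff i = 0) :
    a = ∑ i ∈ Finset.range (d + 1), C σ (a.coeff i) * X σ ^ i := by
  refine SkewPolynomial.ext fun m => ?_
  change a.coeff m = coeff _ m
  simp only [coeff_sum, coeff_C_mul_X_pow, Finset.sum_ite_eq', Finset.mem_range]
  split_ifs with hm
  · rfl
  · exact hd m (by omega)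

theorem coeff_eq_zero_of_degree_lt {a : SkewPolyRing σ} {i : ℕ} (hi : a.degree < i) :
    a.coeff i = 0 :=
  SkewPolynomial.notMem_support_iff.1 fun h => (Finset.le_max h).not_gt hi

theorem coeff_ne_zero_of_degree_eq {a : SkewPolyRing σ} {d : ℕ} (hd : a.degree = d) :
    a.coeff d ≠ 0 :=
  SkewPolynomial.mem_support_iff.1 (Finset.mem_of_max hd)

theorem exists_degree_eq {a : SkewPolyRing σ} (ha : a ≠ 0) : ∃ d : ℕ, a.degree = d :=
  Finset.max_of_nonempty <| Finset.nonempty_iff_ne_empty.2 fun h =>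
    ha (SkewPolynomial.support_eq_empty.1 h)

theorem coeff_mul_add {a b : SkewPolyRing σ} {d e : ℕ} (ha : ∀ i, d < i → a.coeff i = 0)
    (hb : ∀ i, e < i → b.coeff i = 0) :
    (a * b).coeff (d + e) = a.coeff d * (σ ^ d) (b.coeff e) := by
  have hmul (l l' : L) (i j : ℕ) :
      C σ l * X σ ^ i * (C σ l' * X σ ^ j) = C σ (l * (σ ^ i) l') * X σ ^ (i + j) := by
    rw [mul_assoc, ← mul_assoc (X σ ^ i), X_pow_mul_C, map_mul, pow_add]
    simp only [mul_assoc]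
  conv_lhs => rw [eq_sum_C_mul_X_pow a ha, eq_sum_C_mul_X_pow b hb, Finset.sum_mul_sum]
  simp only [hmul, coeff_sum, coeff_C_mul_X_pow]
  rw [Finset.sum_eq_single_of_mem d (Finset.self_mem_range_succ d),
    Finset.sum_eq_single_of_mem e (Finset.self_mem_range_succ e), if_pos rfl]
  · exact fun j _ hj => if_neg (by omega)
  · refine fun i hi hid => Finset.sum_eq_zero fun j hj => if_neg ?_
    have := Finset.mem_range.1 hi
    have := Finset.mem_range.1 hj
    omega

theorem central_C (r : K) : central σ (Polynomial.C r) = C σ (algebraMap K L r) :=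
  eval₂_C _ _

theorem central_X : central σ Polynomial.X = X σ ^ orderOf σ :=
  eval₂_X _ _

theorem coeff_central (F : K[X]) (m : ℕ) :
    (central σ F).coeff m =
      ∑ i ∈ Finset.range (F.natDegree + 1),
        if orderOf σ * i = m then algebraMap K L (F.coeff i) else 0 := by
  conv_lhs => rw [F.as_sum_range_C_mul_X_pow]
  simp only [map_sum, map_mul, map_pow, central_C, central_X, ← pow_mul, coeff_sum,
    coeff_C_mul_X_pow]

theorem coeff_central_of_lt {F : K[X]} {m : ℕ} (hm : orderOf σ * F.natDegree < m) :
    (central σ F).coeff m = 0 := by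
  rw [coeff_central]
  refine Finset.sum_eq_zero fun i hi => if_neg fun him => ?_
  have := Nat.mul_le_mul_left (orderOf σ) (Finset.mem_range_succ_iff.1 hi)
  omega

theorem coeff_central_orderOf_mul_natDegree (F : K[X]) (hσ : 0 < orderOf σ) :
    (central σ F).coeff (orderOf σ * F.natDegree) = algebraMap K L F.leadingCoeff := by
  rw [coeff_central, Finset.sum_eq_single_of_mem _ (Finset.self_mem_range_succ _), if_pos rfl]
  · rfl
  · exact fun i _ hi => if_neg fun h => hi (Nat.eq_of_mul_eq_mul_left hσ h)

theorem nontrivial_quotRing {F : K[X]} (hF : 0 < F.natDegree) (hσ : 0 < orderOf σ) :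
    Nontrivial (QuotRing σ F) := by
  refine Ideal.Quotient.nontrivial_iff.2 fun heq => ?_
  obtain ⟨q, hq⟩ := Ideal.mem_span_singleton'.1 ((Ideal.eq_top_iff_one _).1 heq)
  have coeff_one (m : ℕ) : (1 : SkewPolyRing σ).coeff m = if 0 = m then 1 else 0 := by
    rw [← coeff_C_mul_X_pow (σ := σ), map_one, pow_zero, mul_one]
  have hq0 : q ≠ 0 := by
    rintro rfl
    have h := coeff_one 0
    rw [← hq, zero_mul, if_pos rfl] at h
    exact zero_ne_one h
  obtain ⟨d, hd⟩ := exists_degree_eq hq0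
  have top_coeff := coeff_mul_add (a := q)
    (fun i hi => coeff_eq_zero_of_degree_lt (hd ▸ Nat.cast_lt.2 hi))
    fun i => coeff_central_of_lt (F := F)
  rw [hq, coeff_one, if_neg (by positivity), coeff_central_orderOf_mul_natDegree F hσ] at top_coeff
  refine mul_ne_zero (coeff_ne_zero_of_degree_eq hd) ?_ top_coeff.symm
  simpa using ne_zero_of_natDegree_gt hF

theorem isCyclicPair {F : K[X]} {B : Type*} [Ring B] [Algebra (AdjoinRoot F) B]
    (ψ : QuotRing σ F →ₐ[AdjoinRoot F] B) :
    IsCyclicPair σ ((ψ : QuotRing σ F →+* B).comp ((toQuot σ F).comp (C σ)))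
      (ψ (toQuot σ F (X σ))) (AdjoinRoot.root F) where
  map_algebraMap r := by
    rw [← ψ.commutes]
    exact congrArg (fun a => ψ (toQuot σ F a)) (central_C r).symm
  mul_map l := by
    simp only [RingHom.comp_apply, RingHom.coe_coe, ← map_mul, X_mul_C]
  pow_orderOf := by
    rw [← ψ.commutes, ← map_pow, ← map_pow]
    exact congrArg (fun a => ψ (toQuot σ F a)) central_X.symm

section Image

variable {F : K[X]} {B : Type*} [Ring B] [Algebra (AdjoinRoot F) B]
  (ψ : QuotRing σ F →ₐ[AdjoinRoot F] B)

theorem map_toQuot_eq_sum (a : SkewPolyRing σ) {d : ℕ} (hd : a.degree ≤ d) :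
    ψ (toQuot σ F a) = ∑ i ∈ Finset.range (d + 1),
      (ψ : QuotRing σ F →+* B).comp ((toQuot σ F).comp (C σ)) (a.coeff i) *
        ψ (toQuot σ F (X σ)) ^ i := by
  conv_lhs => rw [eq_sum_C_mul_X_pow a fun i hi =>
    coeff_eq_zero_of_degree_lt (hd.trans_lt (Nat.cast_lt.2 hi))]
  simp only [map_sum, map_mul, map_pow, RingHom.comp_apply, RingHom.coe_coe]

theorem exists_eq_sum_of_surjective (hψ : Function.Surjective ψ) (w : B) :
    ∃ (d : ℕ) (l : ℕ → L), w = ∑ i ∈ Finset.range d,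
      (ψ : QuotRing σ F →+* B).comp ((toQuot σ F).comp (C σ)) (l i) *
        ψ (toQuot σ F (X σ)) ^ i := by
  obtain ⟨q, rfl⟩ := hψ w
  obtain ⟨a, rfl⟩ := Ideal.Quotient.mk_surjective q
  rcases eq_or_ne a 0 with rfl | ha
  · exact ⟨0, 0, by simp⟩
  · obtain ⟨d, hd⟩ := exists_degree_eq ha
    exact ⟨d + 1, a.coeff, map_toQuot_eq_sum ψ a hd.le⟩

end Image

theorem nonempty_algEquiv_matrix [FiniteDimensional K L] [IsGalois K L] [Finite K]
    (hσ : ∀ τ : L ≃ₐ[K] L, τ ∈ Subgroup.zpowers σ) {F : K[X]} (hF : F.Monic)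
    (hirr : Irreducible F) (hFX : F ≠ Polynomial.X) :
    Nonempty (QuotRing σ F ≃ₐ[AdjoinRoot F]
      Matrix (Fin (Module.finrank K L)) (Fin (Module.finrank K L)) (AdjoinRoot F)) := by
  have : Fact (Irreducible F) := ⟨hirr⟩
  have : Module.Finite K (AdjoinRoot F) := hF.finite_adjoinRoot
  have : Finite (AdjoinRoot F) := Module.finite_of_finite K
  have : Nontrivial (QuotRing σ F) := nontrivial_quotRing hirr.natDegree_pos (orderOf_pos σ)
  have root_ne_zero : AdjoinRoot.root F ≠ 0 := by
    rw [← AdjoinRoot.mk_X, Ne, AdjoinRoot.mk_eq_zero]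
    exact fun h => hFX (eq_of_monic_of_associated hF monic_X
      (hirr.associated_of_dvd irreducible_X h))
  let ψ := AlgHom.id (AdjoinRoot F) (QuotRing σ F)
  exact (isCyclicPair ψ).nonempty_algEquiv_matrix hσ root_ne_zero
    (exists_eq_sum_of_surjective ψ Function.surjective_id)

section Rank

variable [FiniteDimensional K L] {F : K[X]} [Fact (Irreducible F)] {W : Type*} [AddCommGroup W]
  [Module (AdjoinRoot F) W] {ψ : QuotRing σ F →ₐ[AdjoinRoot F] Module.End (AdjoinRoot F) W}
  {a : SkewPolyRing σ} {d : ℕ}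

theorem natDegree_mul_finrank_ker_le (hψ : Function.Surjective ψ)
    (hW : Module.finrank (AdjoinRoot F) W = Module.finrank K L) (hd : a.degree = d) :
    F.natDegree * Module.finrank (AdjoinRoot F) (LinearMap.ker (ψ (toQuot σ F a))) ≤ d := by
  have hF : F ≠ 0 := (Fact.out : Irreducible F).ne_zero
  have := (AdjoinRoot.powerBasis hF).finite
  rw [map_toQuot_eq_sum ψ a hd.le, ← finrank_adjoinRoot hF]
  exact (isCyclicPair ψ).finrank_mul_finrank_ker_le hW (exists_eq_sum_of_surjective ψ hψ)
    (coeff_ne_zero_of_degree_eq hd)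

theorem norm_coeff_div_norm_coeff [IsGalois K L] (hσ : ∀ τ : L ≃ₐ[K] L, τ ∈ Subgroup.zpowers σ)
    (hF : F.Monic) (hψ : Function.Surjective ψ)
    (hW : Module.finrank (AdjoinRoot F) W = Module.finrank K L) {k : ℕ}
    (hd : a.degree = (F.natDegree * k : ℕ))
    (hk : Module.finrank (AdjoinRoot F) (LinearMap.ker (ψ (toQuot σ F a))) = k) :
    Algebra.norm K (a.coeff 0) / Algebra.norm K (a.coeff (F.natDegree * k)) =
      (-1) ^ (F.natDegree * k * (Module.finrank K L - 1)) * F.coeff 0 ^ k := by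
  have := hF.finite_adjoinRoot
  have hord := orderOf_eq_finrank_of_forall_mem_zpowers hσ
  have hpair := isCyclicPair ψ
  have norm_det : Algebra.norm K (LinearMap.det (ψ (toQuot σ F (X σ))) ^ k) =
      (-1) ^ (F.natDegree * k) *
        (Algebra.norm K (a.coeff 0) / Algebra.norm K (a.coeff (F.natDegree * k))) := by
    rw [map_toQuot_eq_sum ψ a hd.le] at hk
    rw [← hpair.norm_det_pow_finrank_ker hord hW (exists_eq_sum_of_surjective ψ hψ)
      (coeff_ne_zero_of_degree_eq hd) (by rw [hk, finrank_adjoinRoot hF.ne_zero]), hk]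
  rw [hpair.det_eq hord hW, map_pow, algebraNorm_neg_one_pow_mul, norm_adjoinRoot_root hF,
    finrank_adjoinRoot hF.ne_zero] at norm_det
  refine mul_left_cancel₀ (pow_ne_zero (F.natDegree * k) (neg_ne_zero.2 one_ne_zero)) ?_
  rw [← norm_det]
  ring

end Rank

end SkewPolyRing

end SkewPolynomialQuotient

/-- Let `L/K` be a cyclic Galois extension of degree `n` with Galois group generated by `σ`,
`R = L[x;σ]`, `F ∈ K[y]` monic irreducible of degree `s`, `E = K[y]/(F)`, `R_F = R / R F(xⁿ)`.
If `K` is finite and `F ≠ y` then `R_F` is isomorphic to `M_n(E)`. For every `K` and every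
isomorphism `R_F ≃ M_n(E)`, a nonzero `a` of degree at most `sk` has rank at least `n - k`, and in
case of equality `N(a₀) / N(a_{sk}) = (-1)^{sk(n-1)} F₀ᵏ`. -/
theorem mainTheorem9 {K L : Type*} [Field K] [Field L] [Algebra K L] [FiniteDimensional K L]
    [IsGalois K L] (n : ℕ) (hn : Module.finrank K L = n)
    (σ : L ≃ₐ[K] L) (hσ : ∀ τ : L ≃ₐ[K] L, τ ∈ Subgroup.zpowers σ)
    (F : Polynomial K) (hFmonic : F.Monic) (hFirr : Irreducible F)
    (s : ℕ) (hs : F.natDegree = s) :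
    (Finite K → F ≠ Polynomial.X → Nonempty (SkewPolyRing.QuotRing σ F ≃ₐ[AdjoinRoot F]
        Matrix (Fin n) (Fin n) (AdjoinRoot F))) ∧
    ∀ (φ : SkewPolyRing.QuotRing σ F ≃ₐ[AdjoinRoot F] Matrix (Fin n) (Fin n) (AdjoinRoot F))
      (k : ℕ) (a : SkewPolyRing σ), a ≠ 0 → a.degree ≤ ((s * k : ℕ) : WithBot ℕ) →
        n ≤ (φ (SkewPolyRing.toQuot σ F a)).rank + k ∧
        ((φ (SkewPolyRing.toQuot σ F a)).rank + k = n →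
          a.coeff (s * k) ≠ 0 ∧
          Algebra.norm K (a.coeff 0) / Algebra.norm K (a.coeff (s * k))
            = (-1) ^ (s * k * (n - 1)) * F.coeff 0 ^ k) := by
  subst hn hs
  refine ⟨fun _ hFX => SkewPolyRing.nonempty_algEquiv_matrix hσ hFmonic hFirr hFX, ?_⟩
  intro φ k a ha hdeg
  have : Fact (Irreducible F) := ⟨hFirr⟩
  let ψ := (φ.trans Matrix.toLinAlgEquiv').toAlgHom
  have hψ : Function.Surjective ψ := (φ.trans Matrix.toLinAlgEquiv').surjective
  have hW := Module.finrank_fin_fun (AdjoinRoot F) (n := Module.finrank K L)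
  let A := φ (SkewPolyRing.toQuot σ F a)
  let ν := Module.finrank (AdjoinRoot F) (LinearMap.ker (ψ (SkewPolyRing.toQuot σ F a)))
  have rank_add_nullity : A.rank + ν = Module.finrank K L :=
    A.toLin'.finrank_range_add_finrank_ker.trans hW
  obtain ⟨d, hd⟩ := SkewPolyRing.exists_degree_eq ha
  have hdk : d ≤ F.natDegree * k := Nat.cast_le.1 (hd ▸ hdeg)
  have hνd : F.natDegree * ν ≤ d := SkewPolyRing.natDegree_mul_finrank_ker_le hψ hW hd
  have hνk : ν ≤ k := Nat.le_of_mul_le_mul_left (hνd.trans hdk) hFirr.natDegree_pos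
  refine ⟨rank_add_nullity.ge.trans (Nat.add_le_add_left hνk _), fun hrank => ?_⟩
  have hν : ν = k := Nat.add_left_cancel (rank_add_nullity.trans hrank.symm)
  obtain rfl : d = F.natDegree * k := le_antisymm hdk (hν ▸ hνd)
  exact ⟨SkewPolyRing.coeff_ne_zero_of_degree_eq hd,
    SkewPolyRing.norm_coeff_div_norm_coeff hσ hFmonic hψ hW hd hν⟩
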